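/- Let $V \subseteq \mathbb{C}$ be a domain (a nonempty connected open set, not necessarily simply connected), with boundary $\partial V$ taken in $\mathbb{C}$. Let $f$ be an analytic map (not necessarily injective) from the unit disc $\mathbb{D}$ into $V$ with power series $f(z) = a + \sum_{n=1}^{\infty} a_n z^n$, and suppose that $f$ is B-proper, i.e. for almost every $\theta \in [0,2\pi)$ the radial limit $\lim_{r \nearrow 1} f(re^{i\theta})$ exists and lies in $\partial V$. Let $u$ be a continuous real-valued function on $V$ such that (i$'$) $u$ is twice continuously differentiable and $\Delta u = -4$ on $V$; (ii$'$) $u$ extends continuously to $V \cup \partial V$ with $u = 0$ on $\partial V$; (iii$'$) there is a constant $C > 0$ such that $0 \le u(z) \le C|z|^2 + C$ for all $z \in V$. Then the series $\sum_{n=1}^{\infty} |a_n|^2$ converges and $u(a) = \sum_{n=1}^{\infty} |a_n|^2$. -/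

import Mathlib

open scoped Topology

/-- `f` is a *B-proper* map from the open unit disc into `V`: it is analytic on the disc, takes values
in `V` there, and for almost every `θ ∈ [0, 2π)` the radial limit of `f` at `exp (iθ)` exists and lies
on the boundary of `V`. -/
structure IsBProper (f : ℂ → ℂ) (V : Set ℂ) : Prop where
  analytic : AnalyticOnNhd ℂ f (Metric.ball 0 1)
  mapsTo : Set.MapsTo f (Metric.ball 0 1) V
  radial_limit : ∀ᵐ θ : ℝ ∂(MeasureTheory.volume.restrict (Set.Ico 0 (2 * Real.pi))),
    ∃ w ∈ frontier V,
      Filter.Tendsto (fun r : ℝ => f ((r : ℂ) * Complex.exp ((θ : ℂ) * Complex.I))) (𝓝[<] 1) (𝓝 w)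

/-- The three conditions on a real function `u` on an open set `V` of the plane (values of `u` outside
`V` play no role): `u` is a classical solution of `Δ u = -4` on `V`; it extends continuously to the
boundary of `V` with value `0` there; and it satisfies `0 ≤ u z ≤ C |z|² + C` on `V` for some constant
`C > 0`. -/
structure SolvesTorsion (u : ℂ → ℝ) (V : Set ℂ) : Prop where
  contDiffOn : ContDiffOn ℝ 2 u V
  laplacian_eq : ∀ z ∈ V, Laplacian.laplacian u z = -4
  extends_zero : ∃ U : ℂ → ℝ, ContinuousOn U (closure V) ∧ Set.EqOn U u V ∧
    ∀ w ∈ frontier V, U w = 0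
  growth : ∃ C : ℝ, 0 < C ∧ ∀ z ∈ V, 0 ≤ u z ∧ u z ≤ C * ‖z‖ ^ 2 + C

open Complex InnerProductSpace Metric Filter MeasureTheory

/-! Since `Δ u = -4` and `Δ |z|² = 4`, the function `u + |z|²` is harmonic on `V`, hence so is its
composite with `f` on the disc. The mean value property and Parseval on the circle of radius `r < 1`
give `u(a) + |a|² = A(r) + ∑ |c n|² r^(2n)`, where `A(r)` is the circle mean of `u ∘ f`. As `A(r) ≥
0`, the coefficients are square-summable, and it remains to show `A(r) → 0` as `r → 1`.

B-properness gives `u ∘ f → 0` along almost every radius, but no constant need dominate `u ∘ f`. The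
growth condition bounds it by `C |f|² + C`, and `|f|²` is uniformly integrable over the circles:
subtracting a partial sum `P` leaves a tail whose quadratic mean is small uniformly in `r`.
Dominated convergence handles what is left (`tendsto_circleAverage_comp_zero`). -/

/-- Term-by-term integration of an absolutely convergent trigonometric series against a continuous
function. -/
theorem hasSum_integral_exp_series_mul {b : ℕ → ℂ} (hb : Summable fun n => ‖b n‖) {F g : ℝ → ℂ}
    (hF : ∀ θ : ℝ, HasSum (fun n : ℕ => b n * exp (n * θ * I)) (F θ)) (hg : Continuous g) :
    HasSum (fun n : ℕ => b n * ∫ θ : ℝ in 0..2 * Real.pi, exp (n * θ * I) * g θ)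
      (∫ θ : ℝ in 0..2 * Real.pi, F θ * g θ) := by
  have hnorm (n : ℕ) (θ : ℝ) : ‖exp (n * θ * I)‖ = 1 := by
    simpa using norm_exp_ofReal_mul_I (n * θ)
  have key := intervalIntegral.hasSum_integral_of_dominated_convergence (μ := volume)
    (a := 0) (b := 2 * Real.pi) (F := fun (n : ℕ) (θ : ℝ) => b n * (exp (n * θ * I) * g θ))
    (f := fun θ => F θ * g θ) (fun n θ => ‖b n‖ * ‖g θ‖)
    (fun n => (by fun_prop : Continuous _).aestronglyMeasurable)
    (fun n => .of_forall fun θ _ => by simp [hnorm])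
    (.of_forall fun θ _ => hb.mul_right _)
    (by
      simp_rw [tsum_mul_right]
      exact (by fun_prop : Continuous _).intervalIntegrable _ _)
    (.of_forall fun θ _ => by simpa [mul_assoc] using (hF θ).mul_right (g θ))
  simpa only [intervalIntegral.integral_const_mul] using key

theorem integral_exp_mul_conj_exp (n m : ℕ) :
    ∫ θ : ℝ in 0..2 * Real.pi, exp (n * θ * I) * (starRingEnd ℂ) (exp (m * θ * I)) =
      if n = m then 2 * Real.pi else 0 := by
  have h (θ : ℝ) : exp (n * θ * I) * (starRingEnd ℂ) (exp (m * θ * I)) =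
      exp ((((n : ℂ) - m) * I) * θ) := by
    rw [← exp_conj, ← Complex.exp_add]
    congr 1
    simp
    ring
  simp_rw [h]
  split_ifs with hnm
  · simp [hnm]
  · have hne : ((n : ℂ) - m) * I ≠ 0 :=
      mul_ne_zero (sub_ne_zero.2 (by exact_mod_cast hnm)) I_ne_zero
    rw [integral_exp_mul_complex hne]
    have : exp ((n - m) * I * (2 * Real.pi : ℝ)) = 1 :=
      exp_eq_one_iff.2 ⟨(n : ℤ) - m, by push_cast; ring⟩
    rw [this]
    simp

/-- Parseval's identity for absolutely convergent trigonometric series. -/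
theorem hasSum_norm_sq_of_exp_series {b : ℕ → ℂ} (hb : Summable fun n => ‖b n‖) {F : ℝ → ℂ}
    (hF : ∀ θ : ℝ, HasSum (fun n : ℕ => b n * exp (n * θ * I)) (F θ)) (hFc : Continuous F) :
    HasSum (fun n => ‖b n‖ ^ 2) ((2 * Real.pi)⁻¹ * ∫ θ in 0..2 * Real.pi, ‖F θ‖ ^ 2) := by
  have hcoef (m : ℕ) :
      ∫ θ : ℝ in 0..2 * Real.pi, F θ * (starRingEnd ℂ) (exp (m * θ * I)) =
        b m * (2 * Real.pi) := by
    refine (hasSum_integral_exp_series_mul hb hF (by fun_prop)).unique ?_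
    simp_rw [integral_exp_mul_conj_exp]
    convert hasSum_ite_eq m (b m * (2 * Real.pi : ℂ)) using 2 with n
    split_ifs with h <;> simp [h]
  have hconj (m : ℕ) :
      ∫ θ : ℝ in 0..2 * Real.pi, exp (m * θ * I) * (starRingEnd ℂ) (F θ) =
        (starRingEnd ℂ) (b m) * (2 * Real.pi) := by
    have := congrArg (starRingEnd ℂ) (hcoef m)
    rw [intervalIntegral.integral_of_le Real.two_pi_pos.le, ← integral_conj,
      ← intervalIntegral.integral_of_le Real.two_pi_pos.le] at this
    simpa [mul_comm, mul_left_comm, conj_ofNat] using this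
  -- Pairing `F` with its own conjugate turns the `n`-th term into `b n` times its conjugate, up to
  -- `2π`.
  have key := hasSum_integral_exp_series_mul hb hF (g := fun θ => (starRingEnd ℂ) (F θ))
    (by fun_prop)
  simp_rw [hconj, ← mul_assoc, mul_conj, normSq_eq_norm_sq] at key
  rw [intervalIntegral.integral_ofReal] at key
  have key' : HasSum (fun n => ‖b n‖ ^ 2 * (2 * Real.pi))
      (∫ θ in 0..2 * Real.pi, ‖F θ‖ ^ 2) := by
    rw [← hasSum_ofReal]
    convert key using 2 with n
    push_cast
    ring
  have hcancel (n : ℕ) : (2 * Real.pi)⁻¹ * (‖b n‖ ^ 2 * (2 * Real.pi)) = ‖b n‖ ^ 2 := by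
    field_simp
  simpa only [hcancel] using key'.mul_left (2 * Real.pi)⁻¹

/-- Parseval's identity on a circle inside the disc of convergence of a power series. -/
theorem hasSum_norm_sq_circleAverage {c : ℕ → ℂ} {f : ℂ → ℂ} (hfc : ContinuousOn f (ball 0 1))
    (hc : ∀ z ∈ ball (0 : ℂ) 1, HasSum (fun n : ℕ => c n * z ^ n) (f z))
    {r : ℝ} (hr0 : 0 < r) (hr1 : r < 1) :
    HasSum (fun n => ‖c n‖ ^ 2 * r ^ (2 * n)) (Real.circleAverage (fun z => ‖f z‖ ^ 2) 0 r) := by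
  have hmem (θ : ℝ) : circleMap 0 r θ ∈ ball (0 : ℂ) 1 := by simpa [abs_of_pos hr0] using hr1
  have hb : Summable fun n => ‖c n * (r : ℂ) ^ n‖ :=
    (hc r (by simpa [abs_of_pos hr0] using hr1)).summable.norm
  have hF (θ : ℝ) : HasSum (fun n : ℕ => c n * (r : ℂ) ^ n * exp (n * θ * I))
      (f (circleMap 0 r θ)) := by
    convert hc _ (hmem θ) using 2 with n
    rw [circleMap_zero, mul_pow, ← Complex.exp_nat_mul]
    ring_nf
  have := hasSum_norm_sq_of_exp_series hb hF
    (hfc.comp_continuous (continuous_circleMap 0 r) hmem)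
  rw [Real.circleAverage_def, smul_eq_mul]
  convert this using 2 with n
  simp [abs_of_pos hr0]
  ring

theorem laplacian_norm_sq (z : ℂ) : Laplacian.laplacian (fun w : ℂ => ‖w‖ ^ 2) z = 4 := by
  have h1 : fderiv ℝ (fun w : ℂ => ‖w‖ ^ 2) = fun w => 2 • innerSL ℝ w := by
    ext w : 1
    exact (hasStrictFDerivAt_norm_sq w).hasFDerivAt.fderiv
  have h2 (v : ℂ) :
      fderiv ℝ (fderiv ℝ (fun w : ℂ => ‖w‖ ^ 2)) z v v = 2 * ‖v‖ ^ 2 := by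
    rw [h1]
    have : HasFDerivAt (fun w : ℂ => 2 • innerSL ℝ w) (2 • innerSL ℝ (E := ℂ)) z :=
      (innerSL ℝ (E := ℂ)).hasFDerivAt.const_smul 2
    rw [this.fderiv]
    simp [innerSL_apply_apply ℝ, -Complex.inner]
  rw [laplacian_eq_iteratedFDeriv_complexPlane]
  simp only [iteratedFDeriv_two_apply, Matrix.cons_val_zero, Matrix.cons_val_one, h2]
  norm_num

/-- If `Δ u = -4` then `u + |z|²` is harmonic. -/
theorem SolvesTorsion.harmonicOnNhd {u : ℂ → ℝ} {V : Set ℂ} (hu : SolvesTorsion u V)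
    (hV : IsOpen V) : HarmonicOnNhd (fun z => u z + ‖z‖ ^ 2) V := by
  intro z hz
  have hn (w : ℂ) : ContDiffAt ℝ 2 (fun z : ℂ => ‖z‖ ^ 2) w :=
    (contDiff_norm_sq ℝ).contDiffAt
  have hd (w : ℂ) (hw : w ∈ V) : ContDiffAt ℝ 2 u w :=
    hu.contDiffOn.contDiffAt (hV.mem_nhds hw)
  refine ⟨(hd z hz).add (hn z), ?_⟩
  filter_upwards [hV.mem_nhds hz] with w hw
  have := (hd w hw).laplacian_add (hn w)
  rw [hu.laplacian_eq w hw, laplacian_norm_sq] at this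
  simpa [Pi.add_def] using this

/-- Near `f z`, `h` is the real part of an analytic `G`, so `h ∘ f` is locally the real part of `G ∘
f`. -/
theorem HarmonicAt.comp_analyticAt {h : ℂ → ℝ} {f : ℂ → ℂ} {z : ℂ} (hh : HarmonicAt h (f z))
    (hf : AnalyticAt ℂ f z) : HarmonicAt (h ∘ f) z := by
  obtain ⟨ε, hε, hball⟩ := Metric.isOpen_iff.1 (isOpen_setOfPred_harmonicAt h) (f z) hh
  obtain ⟨G, hG, hGh⟩ := HarmonicOnNhd.exists_analyticOnNhd_ball_re_eq (fun _ hy => hball hy)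
  have hGf : AnalyticAt ℂ (G ∘ f) z := (hG _ (mem_ball_self hε)).comp hf
  refine (harmonicAt_congr_nhds ?_).1 hGf.harmonicAt_re
  filter_upwards [hf.continuousAt.preimage_mem_nhds (ball_mem_nhds _ hε)] with w hw
  exact hGh hw

/-- Mean value identity: `u(f(0)) + |f(0)|²` splits into circle means of `u ∘ f` and `|f|²`. -/
theorem circleAverage_comp_add_circleAverage_norm_sq {u : ℂ → ℝ} {V : Set ℂ}
    (hu : SolvesTorsion u V) (hV : IsOpen V) {f : ℂ → ℂ} (hf : AnalyticOnNhd ℂ f (ball 0 1))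
    (hfV : Set.MapsTo f (ball 0 1) V) {r : ℝ} (hr0 : 0 < r) (hr1 : r < 1) :
    Real.circleAverage (fun z => u (f z)) 0 r + Real.circleAverage (fun z => ‖f z‖ ^ 2) 0 r =
      u (f 0) + ‖f 0‖ ^ 2 := by
  have hsub : closedBall (0 : ℂ) |r| ⊆ ball 0 1 :=
    closedBall_subset_ball (by rwa [abs_of_pos hr0])
  have hmean := InnerProductSpace.HarmonicOnNhd.circleAverage_eq
    (f := (fun z => u z + ‖z‖ ^ 2) ∘ f) (c := 0) (R := r)
    fun z hz => HarmonicAt.comp_analyticAt (hu.harmonicOnNhd hV _ (hfV (hsub hz))) (hf z (hsub hz))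
  have hfc : ContinuousOn f (sphere 0 |r|) :=
    hf.continuousOn.mono (sphere_subset_closedBall.trans hsub)
  rw [← Real.circleAverage_fun_add]
  · exact hmean
  · exact (hu.contDiffOn.continuousOn.comp hfc
      fun z hz => hfV (hsub (sphere_subset_closedBall hz))).circleIntegrable'
  · exact (hfc.norm.pow 2).circleIntegrable'

/-- The tail of a power series has small quadratic means. -/
theorem circleAverage_norm_sq_sub_sum_le {c : ℕ → ℂ} {f : ℂ → ℂ}
    (hfc : ContinuousOn f (ball 0 1))
    (hc : ∀ z ∈ ball (0 : ℂ) 1, HasSum (fun n : ℕ => c n * z ^ n) (f z))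
    (hs : Summable fun n => ‖c n‖ ^ 2) (N : ℕ) {r : ℝ} (hr0 : 0 < r) (hr1 : r < 1) :
    Real.circleAverage (fun z => ‖f z - ∑ n ∈ Finset.range N, c n * z ^ n‖ ^ 2) 0 r ≤
      ∑' n, ‖c (n + N)‖ ^ 2 := by
  have hparse := hasSum_norm_sq_circleAverage (c := fun n => if n < N then 0 else c n)
    (f := fun z => f z - ∑ n ∈ Finset.range N, c n * z ^ n)
    (hfc.sub (by fun_prop)) (fun z hz => by
      have h1 : HasSum (fun n => if n < N then c n * z ^ n else 0)
          (∑ n ∈ Finset.range N, c n * z ^ n) := by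
        have := hasSum_sum_of_ne_finset_zero (f := fun n => if n < N then c n * z ^ n else 0)
          (s := Finset.range N) (L := SummationFilter.unconditional ℕ) (fun n hn => by simp_all)
        rwa [Finset.sum_congr rfl fun n hn => if_pos (Finset.mem_range.1 hn)] at this
      have hterm (n : ℕ) : c n * z ^ n - (if n < N then c n * z ^ n else 0) =
          (if n < N then 0 else c n) * z ^ n := by
        split_ifs <;> simp
      simpa only [hterm] using (hc z hz).sub h1) hr0 hr1
  rw [← hasSum_nat_add_iff' N] at hparse
  rw [Finset.sum_eq_zero fun n hn => by simp [Finset.mem_range.1 hn], sub_zero] at hparse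
  refine hasSum_le (fun n => ?_) hparse ((summable_nat_add_iff N).2 hs).hasSum
  simp only [show ¬ n + N < N by omega, if_false]
  exact mul_le_of_le_one_right (by positivity) (pow_le_one₀ hr0.le hr1.le)

/-- For a B-proper map with square-summable coefficients, the circle means of `u ∘ f` vanish in the
limit. -/
theorem tendsto_circleAverage_comp_zero {u : ℂ → ℝ} {V : Set ℂ}
    (hu : SolvesTorsion u V) {f : ℂ → ℂ} (hf : IsBProper f V) {c : ℕ → ℂ}
    (hc : ∀ z ∈ ball (0 : ℂ) 1, HasSum (fun n : ℕ => c n * z ^ n) (f z))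
    (hs : Summable fun n => ‖c n‖ ^ 2) :
    Tendsto (fun r : ℝ => Real.circleAverage (fun z => u (f z)) 0 r) (𝓝[<] 1) (𝓝 0) := by
  obtain ⟨C, hC, hgrowth⟩ := hu.growth
  obtain ⟨U, hU, hUu, hU0⟩ := hu.extends_zero
  have hfc := hf.analytic.continuousOn
  have hev : ∀ᶠ r : ℝ in 𝓝[<] 1, 0 < r ∧ r < 1 := by
    filter_upwards [Ioo_mem_nhdsLT (show (0 : ℝ) < 1 by norm_num)] with r hr using hr
  have hmem {r : ℝ} (hr : 0 < r ∧ r < 1) (θ : ℝ) : circleMap 0 r θ ∈ ball (0 : ℂ) 1 := by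
    simpa [abs_of_pos hr.1] using hr.2
  have hucont {r : ℝ} (hr : 0 < r ∧ r < 1) : Continuous fun θ => u (f (circleMap 0 r θ)) :=
    (hu.contDiffOn.continuousOn.comp hfc hf.mapsTo).comp_continuous
      (continuous_circleMap 0 r) (hmem hr)
  have hfcont {r : ℝ} (hr : 0 < r ∧ r < 1) : Continuous fun θ => f (circleMap 0 r θ) :=
    hfc.comp_continuous (continuous_circleMap 0 r) (hmem hr)
  have hnonneg {r : ℝ} (hr : 0 < r ∧ r < 1) (θ : ℝ) : 0 ≤ u (f (circleMap 0 r θ)) :=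
    (hgrowth _ (hf.mapsTo (hmem hr θ))).1
  have hae : ∀ᵐ θ : ℝ ∂volume, θ ∈ Set.uIoc 0 (2 * Real.pi) →
      Tendsto (fun r : ℝ => u (f (circleMap 0 r θ))) (𝓝[<] 1) (𝓝 0) := by
    have h1 := (ae_restrict_iff' measurableSet_Ico).1 hf.radial_limit
    -- Interval integrals live on `(0, 2π]`, the radial limits on `[0, 2π)`; the endpoint `2π` is a
    -- null set.
    filter_upwards [h1, (measure_eq_zero_iff_ae_notMem.1
      (Real.volume_singleton (a := 2 * Real.pi)))] with θ hθ hne hmemθ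
    rw [Set.uIoc_of_le Real.two_pi_pos.le] at hmemθ
    obtain ⟨w, hw, hlim⟩ := hθ ⟨hmemθ.1.le, lt_of_le_of_ne hmemθ.2 hne⟩
    have hin : ∀ᶠ r : ℝ in 𝓝[<] 1, f (circleMap 0 r θ) ∈ V :=
      hev.mono fun r hr => hf.mapsTo (hmem hr θ)
    have hlim' : Tendsto (fun r : ℝ => f (circleMap 0 r θ)) (𝓝[<] 1) (𝓝[closure V] w) := by
      refine tendsto_nhdsWithin_iff.2 ⟨?_, hin.mono fun r hr => subset_closure hr⟩
      simpa only [circleMap_zero] using hlim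
    have := (hU w (frontier_subset_closure hw)).tendsto.comp hlim'
    rw [hU0 w hw] at this
    exact this.congr' (hin.mono fun r hr => hUu hr)
  have htail : Tendsto (fun N => 2 * C * ∑' n, ‖c (n + N)‖ ^ 2) atTop (𝓝 0) := by
    simpa using (tendsto_sum_nat_add fun n => ‖c n‖ ^ 2).const_mul (2 * C)
  have hlower : ∀ᶠ r : ℝ in 𝓝[<] 1, 0 ≤ Real.circleAverage (fun z => u (f z)) 0 r := by
    filter_upwards [hev] with r hr
    rw [Real.circleAverage_def]
    exact smul_nonneg (by positivity)
      (intervalIntegral.integral_nonneg Real.two_pi_pos.le fun θ _ => hnonneg hr θ)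
  refine tendsto_order.2 ⟨fun b hb => hlower.mono fun r hr => hb.trans_le hr, fun ε hε => ?_⟩
  -- `N` depends on `ε` only, not on `r`: the tail bound is uniform in the radius.
  obtain ⟨N, hN⟩ := (htail.eventually (gt_mem_nhds (half_pos hε))).exists
  set P : ℂ → ℂ := fun z => ∑ n ∈ Finset.range N, c n * z ^ n
  have hPc : Continuous P := by fun_prop
  set M := ∑ n ∈ Finset.range N, ‖c n‖
  have hPM {z : ℂ} (hz : z ∈ ball (0 : ℂ) 1) : ‖P z‖ ≤ M := by
    refine norm_sum_le_of_le _ fun n _ => ?_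
    rw [norm_mul, norm_pow]
    exact mul_le_of_le_one_right (norm_nonneg _)
      (pow_le_one₀ (norm_nonneg _) (by simpa using (mem_ball_zero_iff.1 hz).le))
  -- Removing `2C |f - P|²` makes `u ∘ f` bounded above, because `|f|² ≤ 2 |f - P|² + 2 M²`. The
  -- positive part lies between `0` and `u ∘ f`, so it still tends to `0` almost everywhere.
  set v : ℝ → ℝ → ℝ := fun r θ =>
    max (u (f (circleMap 0 r θ)) -
      2 * C * ‖f (circleMap 0 r θ) - P (circleMap 0 r θ)‖ ^ 2) 0
  have hPcont (r : ℝ) : Continuous fun θ => P (circleMap 0 r θ) :=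
    hPc.comp (continuous_circleMap 0 r)
  have hdcont {r : ℝ} (hr : 0 < r ∧ r < 1) :
      Continuous fun θ => ‖f (circleMap 0 r θ) - P (circleMap 0 r θ)‖ ^ 2 :=
    ((hfcont hr).sub (hPcont r)).norm.pow 2
  have hvcont {r : ℝ} (hr : 0 < r ∧ r < 1) : Continuous (v r) :=
    ((hucont hr).sub ((hdcont hr).const_mul _)).max continuous_const
  have hvbound {r : ℝ} (hr : 0 < r ∧ r < 1) (θ : ℝ) : ‖v r θ‖ ≤ C + 2 * C * M ^ 2 := by
    have hM : 0 ≤ M := Finset.sum_nonneg fun _ _ => norm_nonneg _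
    rw [Real.norm_of_nonneg (le_max_right _ _)]
    refine max_le ?_ (by positivity)
    have h1 := (hgrowth _ (hf.mapsTo (hmem hr θ))).2
    have h2 := hPM (hmem hr θ)
    set w := f (circleMap 0 r θ)
    set p := P (circleMap 0 r θ)
    have h3 : ‖w‖ ^ 2 ≤ 2 * ‖w - p‖ ^ 2 + 2 * M ^ 2 := by
      have : ‖w‖ ≤ ‖w - p‖ + M := by
        calc ‖w‖ = ‖(w - p) + p‖ := by simp
          _ ≤ ‖w - p‖ + ‖p‖ := norm_add_le _ _
          _ ≤ ‖w - p‖ + M := by gcongr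
      nlinarith [pow_le_pow_left₀ (norm_nonneg w) this 2, sq_nonneg (‖w - p‖ - M)]
    nlinarith [mul_le_mul_of_nonneg_left h3 hC.le]
  have hvlim : Tendsto (fun r => ∫ θ in 0..2 * Real.pi, v r θ) (𝓝[<] 1) (𝓝 0) := by
    have := intervalIntegral.tendsto_integral_filter_of_dominated_convergence
      (μ := volume) (a := 0) (b := 2 * Real.pi) (l := 𝓝[<] (1 : ℝ)) (F := v) (f := fun _ => 0)
      (fun _ => C + 2 * C * M ^ 2)
      (hev.mono fun r hr => (hvcont hr).aestronglyMeasurable)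
      (hev.mono fun r hr => .of_forall fun θ _ => hvbound hr θ)
      intervalIntegrable_const
      (by
        filter_upwards [hae] with θ hθ hmemθ
        refine tendsto_of_tendsto_of_tendsto_of_le_of_le' tendsto_const_nhds (hθ hmemθ)
          (.of_forall fun r => le_max_right _ _) (hev.mono fun r hr => ?_)
        refine max_le ?_ (hnonneg hr θ)
        have : 0 ≤ 2 * C * ‖f (circleMap 0 r θ) - P (circleMap 0 r θ)‖ ^ 2 := by positivity
        linarith)
    simpa using this
  have hvlim' : Tendsto (fun r => (2 * Real.pi)⁻¹ * ∫ θ in 0..2 * Real.pi, v r θ)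
      (𝓝[<] 1) (𝓝 0) := by
    simpa using hvlim.const_mul (2 * Real.pi)⁻¹
  filter_upwards [hev, hvlim'.eventually (gt_mem_nhds (half_pos hε))] with r hr hvr
  have hle : Real.circleAverage (fun z => u (f z)) 0 r ≤
      (2 * Real.pi)⁻¹ * (∫ θ in 0..2 * Real.pi, v r θ) +
        2 * C * Real.circleAverage (fun z => ‖f z - P z‖ ^ 2) 0 r := by
    rw [Real.circleAverage_def, Real.circleAverage_def, smul_eq_mul, smul_eq_mul, mul_left_comm,
      ← mul_add, ← intervalIntegral.integral_const_mul (2 * C),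
      ← intervalIntegral.integral_add ((hvcont hr).intervalIntegrable _ _)
        (((hdcont hr).const_mul _).intervalIntegrable _ _)]
    refine mul_le_mul_of_nonneg_left ?_ (by positivity)
    refine intervalIntegral.integral_mono_on Real.two_pi_pos.le
      ((hucont hr).intervalIntegrable _ _)
      (((hvcont hr).add ((hdcont hr).const_mul _)).intervalIntegrable _ _) fun θ _ => ?_
    have : _ ≤ v r θ := le_max_left _ _
    linarith
  have := mul_le_mul_of_nonneg_left
    (circleAverage_norm_sq_sub_sum_le hfc hc hs N hr.1 hr.2) (show 0 ≤ 2 * C by positivity)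
  linarith

theorem proposition3 (V : Set ℂ) (hVo : IsOpen V) (hVc : IsConnected V)
    (f : ℂ → ℂ) (hf : IsBProper f V)
    (a : ℂ) (c : ℕ → ℂ) (hc0 : c 0 = a)
    (hc : ∀ z ∈ Metric.ball (0 : ℂ) 1, HasSum (fun n : ℕ => c n * z ^ n) (f z))
    (u : ℂ → ℝ) (hu : SolvesTorsion u V) :
    HasSum (fun n : ℕ => ‖c (n + 1)‖ ^ 2) (u a) := by
  have hfc := hf.analytic.continuousOn
  have hf0 : f 0 = a := by
    rw [← hc0]
    refine (hc 0 (by simp)).unique ?_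
    convert hasSum_ite_eq 0 (c 0) using 2 with n
    rcases n with _ | n <;> simp
  have hev : ∀ᶠ r : ℝ in 𝓝[<] 1, 0 < r ∧ r < 1 := by
    filter_upwards [Ioo_mem_nhdsLT (show (0 : ℝ) < 1 by norm_num)] with r hr using hr
  have hmean {r : ℝ} (hr : 0 < r ∧ r < 1) :=
    circleAverage_comp_add_circleAverage_norm_sq hu hVo hf.analytic hf.mapsTo hr.1 hr.2
  have hparse {r : ℝ} (hr : 0 < r ∧ r < 1) := hasSum_norm_sq_circleAverage hfc hc hr.1 hr.2
  obtain ⟨C, hC, hgrowth⟩ := hu.growth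
  have hs : Summable fun n => ‖c n‖ ^ 2 := by
    -- Each finite partial sum is the limit of its `r`-weighted version, which Parseval and `u ≥ 0`
    -- keep below `u a + |a|²`.
    refine summable_of_sum_range_le (c := u a + ‖a‖ ^ 2) (fun _ => by positivity) fun N => ?_
    have hlim : Tendsto (fun r : ℝ => ∑ n ∈ Finset.range N, ‖c n‖ ^ 2 * r ^ (2 * n)) (𝓝[<] 1)
        (𝓝 (∑ n ∈ Finset.range N, ‖c n‖ ^ 2)) := by
      have : Continuous fun r : ℝ => ∑ n ∈ Finset.range N, ‖c n‖ ^ 2 * r ^ (2 * n) := by fun_prop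
      simpa using (this.tendsto 1).mono_left nhdsWithin_le_nhds
    refine le_of_tendsto hlim (hev.mono fun r hr => ?_)
    have h1 := sum_le_hasSum (Finset.range N)
      (fun n _ => mul_nonneg (sq_nonneg _) (pow_nonneg hr.1.le _)) (hparse hr)
    have h2 : 0 ≤ Real.circleAverage (fun z => u (f z)) 0 r := by
      refine Real.circleAverage_nonneg_of_nonneg fun z hz => (hgrowth _ (hf.mapsTo ?_)).1
      rw [abs_of_pos hr.1, mem_sphere] at hz
      exact mem_ball.2 (hz.trans_lt hr.2)
    have := hmean hr
    rw [hf0] at this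
    linarith
  have hsumlim : Tendsto (fun r : ℝ => ∑' n, ‖c n‖ ^ 2 * r ^ (2 * n)) (𝓝[<] 1)
      (𝓝 (∑' n, ‖c n‖ ^ 2)) := by
    refine tendsto_tsum_of_dominated_convergence hs (fun n => ?_) (hev.mono fun r hr n => ?_)
    · have : Continuous fun r : ℝ => ‖c n‖ ^ 2 * r ^ (2 * n) := by fun_prop
      simpa using (this.tendsto 1).mono_left nhdsWithin_le_nhds
    · rw [Real.norm_of_nonneg (mul_nonneg (sq_nonneg _) (pow_nonneg hr.1.le _))]
      exact mul_le_of_le_one_right (sq_nonneg _) (pow_le_one₀ hr.1.le hr.2.le)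
  have hlim := (tendsto_circleAverage_comp_zero hu hf hc hs).add hsumlim
  have htotal : u a + ‖a‖ ^ 2 = ∑' n, ‖c n‖ ^ 2 := by
    rw [zero_add] at hlim
    refine tendsto_nhds_unique (tendsto_const_nhds.congr' (hev.mono fun r hr => ?_)) hlim
    rw [(hparse hr).tsum_eq, hmean hr, hf0]
  -- Restoring the constant term adds `|a|²` to both sides.
  rw [hasSum_nat_add_iff (f := fun n => ‖c n‖ ^ 2) 1]
  simpa [hc0, htotal] using hs.hasSum
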